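/- Let $G=(V,E)$ be a finite mixed graph, i.e. a finite simple graph in which a subset of the edges is oriented. Its Hermitian adjacency matrix $H=(h_{uv})_{u,v\in V}$ has $h_{uv}=i$ if $uv$ is an edge oriented from $u$ to $v$, $h_{uv}=-i$ if it is oriented from $v$ to $u$, $h_{uv}=1$ if $uv$ is an unoriented edge, and $h_{uv}=0$ otherwise. Let $L_H=D-H$, where $D$ is the diagonal matrix of the vertex degrees in the underlying graph of $G$; for $W\subseteq V$ let $L_H[W]$ be the principal submatrix of $L_H$ with rows and columns indexed by $W$ (the empty determinant is $1$). A substructure of $G$ is a pair $R=(X,Y)$ with $X=V(R)\subseteq V$ and $Y\subseteq E$, where ends of edges in $Y$ need not lie in $X$; it is square if $|X|=|Y|$. Its components are the substructures given by the connected components of the bipartite incidence graph on $X\sqcup Y$, in which $x\in X$ is joined to $e\in Y$ when $x$ is an end of $e$. A rootless tree is a substructure $(V(T)\setminus\{r\},E(T))$, where $T$ is a tree that is a subgraph of $G$ and $r\in V(T)$. A unicyclic graph is a connected graph with exactly one cycle. For a cycle $C$ of $G$ traversed in one of its two directions, let $a$ and $b$ be the numbers of its oriented edges that are oriented along and against the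 direction of traversal. The cycle is of type I if $a+b$ is odd, of type IV if $|a-b|/2$ is an odd integer, and of type V if $|a-b|/2$ is an even integer; a unicyclic graph is of the type of its cycle. A super special square substructure is a square substructure each of whose components is a rootless tree or a unicyclic graph not of type V. Then for every $W\subseteq V$ $$\det(L_H[W])=\sum_R 2^{p(R)+2q(R)},$$ where the sum runs over all super special square substructures $R$ of $G$ with $V(R)=W$, and $p(R)$ and $q(R)$ denote the numbers of components of $R$ that are unicyclic graphs of type I and of type IV, respectively. -/

import Mathlib

/-- A mixed graph on `V`: a simple graph in which a subset of the edges is oriented.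
`arc u v` says that the edge `uv` is oriented from `u` to `v`. -/
structure MixedGraph (V : Type*) where
  /-- the underlying (unoriented) simple graph -/
  graph : SimpleGraph V
  /-- the oriented edges -/
  arc : V → V → Prop
  arc_adj : ∀ {u v : V}, arc u v → graph.Adj u v
  arc_asymm : ∀ {u v : V}, arc u v → ¬ arc v u

namespace MixedGraph

variable {V : Type*}

open Classical in
/-- The Hermitian adjacency matrix `H(G)`: the entry at `(u, v)` is `i` if `u → v`, `-i` if
`v → u`, `1` if `uv` is an unoriented edge, and `0` otherwise. -/
noncomputable def hermitianAdjacency (G : MixedGraph V) : Matrix V V ℂ :=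
  Matrix.of fun u v =>
    if G.arc u v then Complex.I
    else if G.arc v u then -Complex.I
    else if G.graph.Adj u v then 1
    else 0

open Classical in
/-- The Hermitian Laplacian matrix `L_H(G) = D(G) - H(G)`, where `D(G)` is the diagonal matrix of
the degrees in the underlying graph. -/
noncomputable def hermitianLaplacian [Fintype V] [DecidableEq V] (G : MixedGraph V) :
    Matrix V V ℂ :=
  Matrix.diagonal (fun v => (G.graph.degree v : ℂ)) - G.hermitianAdjacency

section Cycles

variable {G : MixedGraph V} {v : V}

open Classical in
/-- The number `a` of edges of a walk that are oriented along the walk. -/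
noncomputable def forwardCount (c : G.graph.Walk v v) : ℕ :=
  c.darts.countP (fun d => G.arc d.fst d.snd)

open Classical in
/-- The number `b` of edges of a walk that are oriented against the walk. -/
noncomputable def backwardCount (c : G.graph.Walk v v) : ℕ :=
  c.darts.countP (fun d => G.arc d.snd d.fst)

/-- Type I: the total number of oriented edges is odd. -/
def TypeI (c : G.graph.Walk v v) : Prop :=
  Odd (forwardCount c + backwardCount c)

/-- Type IV: `|a - b| / 2` is an odd integer. -/
def TypeIV (c : G.graph.Walk v v) : Prop :=
  ∃ k : ℤ, Odd k ∧ |(forwardCount c : ℤ) - backwardCount c| = 2 * k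

/-- Type V: `|a - b| / 2` is an even integer. -/
def TypeV (c : G.graph.Walk v v) : Prop :=
  ∃ k : ℤ, Even k ∧ |(forwardCount c : ℤ) - backwardCount c| = 2 * k

end Cycles

/-- A substructure of a mixed graph: a set of vertices together with a set of edges of the graph;
the end vertices of the chosen edges need not be among the chosen vertices. -/
@[ext]
structure Substructure (G : MixedGraph V) where
  /-- the chosen vertices -/
  verts : Set V
  /-- the chosen edges -/
  edges : Set (Sym2 V)
  edges_subset : edges ⊆ G.graph.edgeSet

namespace Substructure

variable {G : MixedGraph V}

instance [Finite V] : Finite G.Substructure :=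
  Finite.of_injective (fun R : G.Substructure => (R.verts, R.edges)) (by
    intro R S h
    exact Substructure.ext (congrArg Prod.fst h) (congrArg Prod.snd h))

/-- Equal number of vertices and edges. -/
def IsSquare (R : G.Substructure) : Prop :=
  R.verts.ncard = R.edges.ncard

/-- The vertex-edge incidence graph of a substructure: a vertex of `R` is joined to each edge of
`R` that it is an end of. -/
def incidenceGraph (R : G.Substructure) : SimpleGraph (R.verts ⊕ R.edges) :=
  SimpleGraph.fromRel fun x y =>
    ∃ (v : R.verts) (e : R.edges), x = Sum.inl v ∧ y = Sum.inr e ∧ (v : V) ∈ (e : Sym2 V)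

/-- The components of a substructure (two edges of `R` are not connected through a common end
that is missing from `R`, and an edge of `R` with both ends missing is a component). -/
abbrev Component (R : G.Substructure) : Type _ :=
  R.incidenceGraph.ConnectedComponent

/-- A component, as a substructure of `G`. -/
def component (R : G.Substructure) (C : R.Component) : G.Substructure where
  verts := {v | ∃ h : v ∈ R.verts, R.incidenceGraph.connectedComponentMk (Sum.inl ⟨v, h⟩) = C}
  edges := {e | ∃ h : e ∈ R.edges, R.incidenceGraph.connectedComponentMk (Sum.inr ⟨e, h⟩) = C}
  edges_subset := fun _ he => R.edges_subset he.1

/-- A rootless tree: obtained from a tree `T` by deleting one vertex, the root, while keeping all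
the edges of `T`. -/
def IsRootlessTree (R : G.Substructure) : Prop :=
  ∃ T : G.graph.Subgraph, T.coe.IsTree ∧
    ∃ r ∈ T.verts, R.verts = T.verts \ {r} ∧ R.edges = T.edgeSet

/-- `R` is a connected graph (in particular it contains all ends of its edges). -/
def IsConnectedGraph (R : G.Substructure) : Prop :=
  ∃ H : G.graph.Subgraph, H.coe.Connected ∧ R.verts = H.verts ∧ R.edges = H.edgeSet

/-- The closed walk `c` runs once around a cycle all of whose edges belong to `R`. -/
def HasCycle (R : G.Substructure) {v : V} (c : G.graph.Walk v v) : Prop :=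
  c.IsCycle ∧ ∀ e ∈ c.edges, e ∈ R.edges

/-- A unicyclic graph: a connected graph with exactly one cycle (walks around the same cycle from
different starting points or in different directions are identified by their edges). -/
def IsUnicyclic (R : G.Substructure) : Prop :=
  R.IsConnectedGraph ∧
    (∃ (v : V) (c : G.graph.Walk v v), R.HasCycle c) ∧
    ∀ (u v : V) (c : G.graph.Walk u u) (c' : G.graph.Walk v v),
      R.HasCycle c → R.HasCycle c' → ∀ e, e ∈ c.edges ↔ e ∈ c'.edges

/-- A unicyclic graph whose cycle is of type I. -/
def IsUnicyclicTypeI (R : G.Substructure) : Prop :=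
  R.IsUnicyclic ∧ ∃ (v : V) (c : G.graph.Walk v v), R.HasCycle c ∧ TypeI c

/-- A unicyclic graph whose cycle is of type IV. -/
def IsUnicyclicTypeIV (R : G.Substructure) : Prop :=
  R.IsUnicyclic ∧ ∃ (v : V) (c : G.graph.Walk v v), R.HasCycle c ∧ TypeIV c

/-- A unicyclic graph whose cycle is of type V. -/
def IsUnicyclicTypeV (R : G.Substructure) : Prop :=
  R.IsUnicyclic ∧ ∃ (v : V) (c : G.graph.Walk v v), R.HasCycle c ∧ TypeV c

/-- A super special square substructure: a square substructure each component of which is a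
rootless tree or a unicyclic graph not of type V. -/
def IsSuperSpecial (R : G.Substructure) : Prop :=
  R.IsSquare ∧ ∀ C : R.Component,
    (R.component C).IsRootlessTree ∨
      ((R.component C).IsUnicyclic ∧ ¬ (R.component C).IsUnicyclicTypeV)

/-- The number `p` of components that are unicyclic of type I. -/
noncomputable def numTypeI (R : G.Substructure) : ℕ :=
  {C : R.Component | (R.component C).IsUnicyclicTypeI}.ncard

/-- The number `q` of components that are unicyclic of type IV. -/
noncomputable def numTypeIV (R : G.Substructure) : ℕ :=
  {C : R.Component | (R.component C).IsUnicyclicTypeIV}.ncard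

end Substructure

/-- The finite set of the super special square substructures of `G` with vertex set `W`. -/
noncomputable def superSpecialOn [Finite V] (G : MixedGraph V) (W : Finset V) :
    Finset G.Substructure :=
  (Set.toFinite {R : G.Substructure | R.IsSuperSpecial ∧ R.verts = (W : Set V)}).toFinset

end MixedGraph

/-! Over the Gaussian integers `L_H = S S*` for an incidence matrix `S` whose column at an edge has
unit entries at the two ends and zeros elsewhere. Cauchy–Binet writes `det L_H[W]` as a sum over
edge sets `Y` with `|Y| = |W|` of the Gram determinants of `S` restricted to `(W, Y)`, and each of
these is the product of the Gram determinants of the components (`gramDet_eq_prod_component`). A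
component with fewer edges than vertices contributes 0, so in a nonzero term all components are
square. The Gram determinant of a square component is the norm of `det S`. If some edge has an end
outside the component, counting makes it a rootless tree and `det S` is a unit
(`IsLinked.gramDet_eq_one`). Otherwise it is unicyclic, and `det S` is a unit times `1 - w`, where
`w` is the product of the weights around the cycle (`IsLinked.gramDet_eq_norm_one_sub`). Here `w` is
`±i`, `-1` or `1` for types I, IV and V, giving norms 2, 4 and 0. -/

namespace Matrix

/-! ### Cauchy–Binet, with the terms indexed by sets of columns -/

/-- Multilinear expansion of the determinant of a product, along functions choosing one summand
in each row. -/
theorem det_sum_mul_eq_sum_piFinset {m n A : Type*} [Fintype m] [DecidableEq m] [CommRing A]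
    (E : Finset n) (M : m → n → A) (N : n → m → A) :
    (Matrix.of fun i k => ∑ e ∈ E, M i e * N e k).det =
      ∑ f ∈ Fintype.piFinset (fun _ : m => E),
        (∏ i, M i (f i)) * (Matrix.of fun i k => N (f i) k).det := by
  have h : (Matrix.of fun i k => ∑ e ∈ E, M i e * N e k) =
      fun i => ∑ e ∈ E, M i e • N e := by
    ext i k
    simp [Finset.sum_apply]
  rw [h]
  change Matrix.detRowAlternating (fun i => ∑ e ∈ E, M i e • N e) = _
  rw [← AlternatingMap.coe_multilinearMap, MultilinearMap.map_sum_finset]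
  refine Finset.sum_congr rfl fun f _ => ?_
  rw [MultilinearMap.map_smul_univ (Matrix.detRowAlternating (R := A) (n := m)).toMultilinearMap
    (fun i => M i (f i)) (fun i => N (f i))]
  rfl

/-- The Cauchy–Binet formula: the determinant of a product is the sum, over the sets of columns
of the right size, of the determinants of the products restricted to these columns. -/
theorem det_sum_mul_eq_sum_powersetCard {m n A : Type*} [Fintype m] [DecidableEq m] [CommRing A]
    [DecidableEq n] (E : Finset n) (M : m → n → A) (N : n → m → A) :
    (Matrix.of fun i k => ∑ e ∈ E, M i e * N e k).det =
      ∑ s ∈ E.powersetCard (Fintype.card m),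
        (Matrix.of fun i k => ∑ e ∈ s, M i e * N e k).det := by
  classical
  set t : (m → n) → A := fun f => (∏ i, M i (f i)) * (Matrix.of fun i k => N (f i) k).det
    with ht
  have hzero : ∀ f : m → n, ¬ Function.Injective f → t f = 0 := by
    intro f hf
    obtain ⟨i, j, hij, hne⟩ : ∃ i j, f i = f j ∧ i ≠ j := by
      simpa [Function.Injective] using hf
    rw [ht]
    simp only
    rw [Matrix.det_zero_of_row_eq hne, mul_zero]
    ext k
    simp [hij]
  have hfib : ∀ s ∈ E.powersetCard (Fintype.card m),
      (Matrix.of fun i k => ∑ e ∈ s, M i e * N e k).det =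
        ∑ f ∈ (Fintype.piFinset (fun _ : m => E)).filter Function.Injective with
          Finset.univ.image f = s, t f := by
    intro s hs
    rw [Finset.mem_powersetCard] at hs
    rw [det_sum_mul_eq_sum_piFinset]
    symm
    apply Finset.sum_subset
    · intro f hf
      simp only [Finset.mem_filter] at hf
      rw [Fintype.mem_piFinset]
      intro i
      rw [← hf.2]
      exact Finset.mem_image_of_mem _ (Finset.mem_univ _)
    · intro f hf hf'
      apply hzero
      intro hinj
      apply hf'
      rw [Fintype.mem_piFinset] at hf
      simp only [Finset.mem_filter, Fintype.mem_piFinset]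
      refine ⟨⟨fun i => hs.1 (hf i), hinj⟩, ?_⟩
      apply Finset.eq_of_subset_of_card_le
      · intro e he
        obtain ⟨i, -, rfl⟩ := Finset.mem_image.1 he
        exact hf i
      · rw [Finset.card_image_of_injective _ hinj, hs.2, Finset.card_univ]
  rw [Finset.sum_congr rfl hfib, det_sum_mul_eq_sum_piFinset, Finset.sum_fiberwise_of_maps_to]
  · rw [Finset.sum_filter_of_ne]
    intro f _ hne
    by_contra hinj
    exact hne (hzero f hinj)
  · intro f hf
    simp only [Finset.mem_filter, Fintype.mem_piFinset] at hf
    rw [Finset.mem_powersetCard]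
    refine ⟨?_, by rw [Finset.card_image_of_injective _ hf.2, Finset.card_univ]⟩
    intro e he
    obtain ⟨i, -, rfl⟩ := Finset.mem_image.1 he
    exact hf.1 i

end Matrix

/-! ### Gram determinants of restricted incidence matrices -/

section GramDet

variable {V : Type*} [Fintype V]

open Classical in
/-- The determinant of `S Sᴴ`, where `S` is restricted to the rows in `X` and the columns
in `Y`. -/
noncomputable def gramDet (S : V → Sym2 V → GaussianInt) (X : Set V) (Y : Set (Sym2 V)) :
    GaussianInt :=
  (Matrix.of fun u v : X => ∑ e ∈ Y.toFinset, S u e * star (S v e)).det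

theorem gramDet_eq_det_of_equiv (S : V → Sym2 V → GaussianInt) {X : Set V} {Y : Set (Sym2 V)}
    {ι : Type*} [Fintype ι] [DecidableEq ι] (σ : ι ≃ X) {E : Finset (Sym2 V)}
    (hE : (E : Set (Sym2 V)) = Y) :
    gramDet S X Y = (Matrix.of fun i j => ∑ e ∈ E, S (σ i) e * star (S (σ j) e)).det := by
  classical
  subst hE
  rw [gramDet, ← Matrix.det_submatrix_equiv_self σ]
  congr 1
  ext1 i j
  simp

theorem gramDet_eq_sum_powersetCard (S : V → Sym2 V → GaussianInt) {X : Set V}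
    {E : Finset (Sym2 V)} :
    gramDet S X E = ∑ s ∈ E.powersetCard X.ncard, gramDet S X s := by
  classical
  rw [gramDet_eq_det_of_equiv S (Equiv.refl X) rfl]
  simp only [Equiv.refl_apply]
  rw [Matrix.det_sum_mul_eq_sum_powersetCard (M := fun (u : X) e => S u e) (N := fun e (v : X) => star (S v e)),
    ← Nat.card_eq_fintype_card, Nat.card_coe_set_eq]
  exact Finset.sum_congr rfl fun s _ => (gramDet_eq_det_of_equiv S (Equiv.refl X) rfl).symm

theorem gramDet_eq_zero_of_ncard_lt (S : V → Sym2 V → GaussianInt) {X : Set V}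
    {Y : Set (Sym2 V)} (h : Y.ncard < X.ncard) : gramDet S X Y = 0 := by
  classical
  rw [← Set.coe_toFinset Y, gramDet_eq_sum_powersetCard, Finset.powersetCard_eq_empty.2,
    Finset.sum_empty]
  rwa [← Set.ncard_eq_toFinset_card']

/-- The restricted matrix is square once `σ` labels its columns by vertices. Another labelling
changes its determinant by a sign at most, which the norm does not see. -/
theorem gramDet_eq_norm_det {S : V → Sym2 V → GaussianInt} {X : Set V}
    {Y : Set (Sym2 V)} [Fintype X] [DecidableEq X] (σ : X ≃ Y) :
    gramDet S X Y = ((Matrix.of fun u v : X => S u (σ v)).det.norm : GaussianInt) := by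
  classical
  rw [Zsqrtd.norm_eq_mul_conj, gramDet]
  have h : (Matrix.of fun u v : X => ∑ e ∈ Y.toFinset, S u e * star (S v e)) =
      (Matrix.of fun u v : X => S u (σ v)) * (Matrix.of fun u v : X => S u (σ v)).conjTranspose := by
    ext1 u v
    simp only [Matrix.of_apply, Matrix.mul_apply, Matrix.conjTranspose_apply]
    rw [← Finset.sum_coe_sort]
    symm
    refine Fintype.sum_equiv (σ.trans (Equiv.subtypeEquivRight fun e => by simp)) _ _ ?_
    intro x
    rfl
  have h2 := congrArg Matrix.det h
  rw [Matrix.det_mul, Matrix.det_conjTranspose] at h2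
  convert h2

end GramDet

/-! ### Column relations along edges and walks -/

namespace MixedGraph

variable {V : Type*}

/-- `S` is an incidence matrix which factors the matrix with off-diagonal entries `-h u v`. -/
structure IsIncidence (G : MixedGraph V) (h : V → V → GaussianInt)
    (S : V → Sym2 V → GaussianInt) : Prop where
  eq_zero : ∀ {x : V} {e : Sym2 V}, x ∉ e → S x e = 0
  mul_star_self : ∀ {u v : V}, G.graph.Adj u v → S u s(u, v) * star (S u s(u, v)) = 1
  mul_star : ∀ {u v : V}, G.graph.Adj u v → S u s(u, v) * star (S v s(u, v)) = -h u v

/-- The product of the weights `h` along a walk, read backwards. -/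
def walkWeight {G : MixedGraph V} (h : V → V → GaussianInt) {u v : V} (p : G.graph.Walk u v) :
    GaussianInt :=
  (p.darts.map fun d => h d.snd d.fst).prod

open Classical in
/-- The restriction to `X` of the unit vector at a vertex. -/
noncomputable def unitVec (X : Set V) (u : V) : X → GaussianInt := fun x => if (x : V) = u then 1 else 0

theorem unitVec_eq_zero {X : Set V} {u : V} (hu : u ∉ X) : unitVec X u = 0 := by
  ext1 x
  rw [unitVec, if_neg, Pi.zero_apply]
  rintro rfl
  exact hu x.2

theorem unitVec_eq_single {X : Set V} [DecidableEq X] (u : X) :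
    unitVec X u = Pi.single u 1 := by
  ext1 x
  by_cases hx : x = u <;> simp [unitVec, hx, Subtype.ext_iff.symm]

/-- The column of `S` at `e`, restricted to `X`. -/
def edgeVec (S : V → Sym2 V → GaussianInt) (X : Set V) (e : Sym2 V) : X → GaussianInt :=
  fun x => S x e

namespace IsIncidence

variable {G : MixedGraph V} {h : V → V → GaussianInt} {S : V → Sym2 V → GaussianInt}

/-- Since the entry at `u` has modulus 1, `mul_star` gives `S v = -h v u * S u` on this edge. An end
outside `X` needs no separate case, because its `unitVec` is 0. -/
theorem edgeVec_eq (hS : G.IsIncidence h S) (X : Set V) {u v : V} (huv : G.graph.Adj u v) :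
    edgeVec S X s(u, v) = S u s(u, v) • (unitVec X u - h v u • unitVec X v) := by
  have h1 := hS.mul_star_self huv
  have h2 := hS.mul_star huv.symm
  rw [Sym2.eq_swap] at h2
  have hne := huv.ne
  ext1 x
  simp only [edgeVec, unitVec, Pi.smul_apply, Pi.sub_apply, smul_eq_mul]
  by_cases hxu : (x : V) = u
  · rw [hxu]
    simp [hne]
  by_cases hxv : (x : V) = v
  · rw [hxv]
    simp only [hne.symm, if_false, if_true]
    linear_combination (-S v s(u, v)) * h1 + S u s(u, v) * h2
  · rw [hS.eq_zero (by simp [hxu, hxv])]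
    simp [hxu, hxv]

theorem unitVec_sub_mem (hS : G.IsIncidence h S) {X : Set V} {u v : V} (huv : G.graph.Adj u v)
    {N : Submodule GaussianInt (X → GaussianInt)} (hN : edgeVec S X s(u, v) ∈ N) :
    unitVec X u - h v u • unitVec X v ∈ N := by
  have := N.smul_mem (star (S u s(u, v))) hN
  rwa [hS.edgeVec_eq X huv, smul_smul, mul_comm, hS.mul_star_self huv, one_smul] at this

/-- The edge relations `e_u ≡ h w u • e_w` modulo `N` telescope along the walk; this is why
`walkWeight` reads `h` backwards. -/
theorem unitVec_sub_walkWeight_mem (hS : G.IsIncidence h S) {X : Set V}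
    {N : Submodule GaussianInt (X → GaussianInt)} {u v : V} (p : G.graph.Walk u v)
    (hp : ∀ e ∈ p.edges, edgeVec S X e ∈ N) :
    unitVec X u - walkWeight h p • unitVec X v ∈ N := by
  induction p with
  | nil => simp [walkWeight]
  | @cons u w v huw p ih =>
    simp only [SimpleGraph.Walk.edges_cons, List.mem_cons, forall_eq_or_imp] at hp
    have h1 := hS.unitVec_sub_mem huw hp.1
    have h2 := N.add_mem h1 (N.smul_mem (h w u) (ih hp.2))
    convert h2 using 1
    simp only [walkWeight, SimpleGraph.Walk.darts_cons, List.map_cons, List.prod_cons, smul_sub,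
      smul_smul]
    abel

end IsIncidence

namespace Substructure

variable {G : MixedGraph V} {h : V → V → GaussianInt} {S : V → Sym2 V → GaussianInt}

/-- A substructure with a vertex whose incidence graph is connected. -/
structure IsLinked (R : G.Substructure) : Prop where
  nonempty : R.verts.Nonempty
  exists_mem : ∀ e ∈ R.edges, ∃ v ∈ e, v ∈ R.verts
  subset_of_closed : ∀ s : Set V, (∃ u ∈ R.verts, u ∈ s) →
    (∀ e ∈ R.edges, ∀ u ∈ e, ∀ v ∈ e, u ∈ R.verts → v ∈ R.verts → u ∈ s → v ∈ s) → R.verts ⊆ s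

/-- Membership of unit vectors in `N` spreads across edges, hence over all of a linked substructure.
The second alternative in `hN` allows for an edge whose column has been replaced. -/
theorem IsLinked.unitVec_mem {R : G.Substructure} (hR : R.IsLinked) (hS : G.IsIncidence h S)
    {N : Submodule GaussianInt (R.verts → GaussianInt)} {u : V} (hu : u ∈ R.verts)
    (huN : unitVec R.verts u ∈ N)
    (hN : ∀ e ∈ R.edges, edgeVec S R.verts e ∈ N ∨ ∀ x ∈ e, unitVec R.verts x ∈ N)
    {v : V} (hv : v ∈ R.verts) : unitVec R.verts v ∈ N := by
  refine hR.subset_of_closed {v | unitVec R.verts v ∈ N} ⟨u, hu, huN⟩ ?_ hv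
  intro e he x hx y hy _ _ hxN
  rcases hN e he with h1 | h1
  · by_cases hxy : x = y
    · rwa [← hxy]
    · have he' := R.edges_subset he
      rw [(Sym2.mem_and_mem_iff hxy).1 ⟨hx, hy⟩, Sym2.eq_swap] at h1 he'
      have h2 := hS.unitVec_sub_mem (by simpa using he') h1
      simpa using N.add_mem h2 (N.smul_mem (h x y) hxN)
  · exact h1 y hy

end Substructure

end MixedGraph

theorem Matrix.isUnit_det_of_single_mem_span {n A : Type*} [Fintype n] [DecidableEq n]
    [CommRing A] (M : Matrix n n A)
    (hM : ∀ j, Pi.single j 1 ∈ Submodule.span A (Set.range M.col)) : IsUnit M.det := by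
  rw [← Matrix.isUnit_iff_isUnit_det, ← Matrix.mulVec_surjective_iff_isUnit]
  have : LinearMap.range M.mulVecLin = ⊤ := by
    rw [Matrix.range_mulVecLin, eq_top_iff, ← (Pi.basisFun A n).span_eq, Submodule.span_le]
    rintro _ ⟨j, rfl⟩
    simpa using hM j
  intro b
  obtain ⟨x, hx⟩ := LinearMap.range_eq_top.1 this b
  exact ⟨x, hx⟩

/-! ### The Gram determinant of a linked square substructure -/

namespace MixedGraph.Substructure

variable {V : Type*} [Fintype V] {G : MixedGraph V} {h : V → V → GaussianInt}
  {S : V → Sym2 V → GaussianInt}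

theorem IsSquare.exists_equiv {R : G.Substructure} (hsq : R.IsSquare) :
    Nonempty (R.verts ≃ R.edges) := by
  classical
  refine ⟨Fintype.equivOfCardEq ?_⟩
  rwa [← Nat.card_eq_fintype_card, ← Nat.card_eq_fintype_card, Nat.card_coe_set_eq,
    Nat.card_coe_set_eq]

/-- The column of `e` is a unit multiple of a single unit vector, as the end `z` is cut off. From
there all unit vectors lie in the column span, so the determinant is a unit, of norm 1. -/
theorem IsLinked.gramDet_eq_one {R : G.Substructure} (hR : R.IsLinked) (hsq : R.IsSquare)
    (hS : G.IsIncidence h S) {e : Sym2 V} (he : e ∈ R.edges) {z : V} (hz : z ∈ e)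
    (hzR : z ∉ R.verts) : gramDet S R.verts R.edges = 1 := by
  classical
  obtain ⟨σ⟩ := hsq.exists_equiv
  rw [gramDet_eq_norm_det σ]
  rw [(Zsqrtd.norm_eq_one_iff' (by norm_num) _).2, Int.cast_one]
  apply Matrix.isUnit_det_of_single_mem_span
  set N := Submodule.span GaussianInt
    (Set.range (Matrix.of fun u v : R.verts => S u (σ v)).col) with hN
  have hcol : ∀ e ∈ R.edges, edgeVec S R.verts e ∈ N := by
    intro e he
    refine Submodule.subset_span ⟨σ.symm ⟨e, he⟩, ?_⟩
    ext1 x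
    simp [edgeVec, Matrix.col]
  obtain ⟨u, hue, huR⟩ := hR.exists_mem e he
  have hne : u ≠ z := by
    rintro rfl
    exact hzR huR
  have huN : unitVec R.verts u ∈ N := by
    have he' := R.edges_subset he
    have h1 := hcol e he
    rw [(Sym2.mem_and_mem_iff hne).1 ⟨hue, hz⟩] at h1 he'
    have h2 := hS.unitVec_sub_mem (by simpa using he') h1
    simpa [unitVec_eq_zero hzR] using h2
  intro j
  rw [← unitVec_eq_single]
  exact hR.unitVec_mem hS huR huN (fun e he => Or.inl (hcol e he)) j.2

/-- Let `vw` be the first edge of the cycle and `p` the rest. Modulo the other columns, `p` gives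
`e_w ≡ walkWeight h p • e_v`, so the column of `vw` reduces to a unit times `(1 - walkWeight h c) •
e_v`. With `e_v` itself in that column the determinant is a unit. -/
theorem IsLinked.gramDet_eq_norm_one_sub {R : G.Substructure} (hR : R.IsLinked)
    (hsq : R.IsSquare) (hS : G.IsIncidence h S)
    (hends : ∀ e ∈ R.edges, ∀ x ∈ e, x ∈ R.verts) {v : V} {c : G.graph.Walk v v}
    (hc : R.HasCycle c) :
    gramDet S R.verts R.edges = ((1 - walkWeight h c).norm : GaussianInt) := by
  classical
  obtain ⟨σ⟩ := hsq.exists_equiv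
  rw [gramDet_eq_norm_det σ]
  obtain ⟨hcyc, hcR⟩ := hc
  cases c with
  | nil => exact absurd rfl hcyc.ne_nil
  | @cons _ w _ hvw p =>
  simp only [SimpleGraph.Walk.edges_cons, List.mem_cons, forall_eq_or_imp] at hcR
  obtain ⟨he0, hpR⟩ := hcR
  have hnot : s(v, w) ∉ p.edges := by
    have := hcyc.isTrail.edges_nodup
    rw [SimpleGraph.Walk.edges_cons, List.nodup_cons] at this
    exact this.1
  set M : Matrix R.verts R.verts GaussianInt := Matrix.of fun u v : R.verts => S u (σ v) with hM
  set j₀ : R.verts := σ.symm ⟨s(v, w), he0⟩ with hj₀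
  have hMcol : ∀ j, M.col j = edgeVec S R.verts (σ j) := fun j => rfl
  set N := Submodule.span GaussianInt (M.col '' {j | j ≠ j₀}) with hN
  have hcol : ∀ e ∈ R.edges, e ≠ s(v, w) → edgeVec S R.verts e ∈ N := by
    intro e he hne
    refine Submodule.subset_span ⟨σ.symm ⟨e, he⟩, ?_, ?_⟩
    · intro hj
      rw [hj₀, σ.symm.injective.eq_iff, Subtype.mk.injEq] at hj
      exact hne hj
    · rw [hMcol]
      simp
  have hwN : unitVec R.verts w - walkWeight h p • unitVec R.verts v ∈ N := by
    apply hS.unitVec_sub_walkWeight_mem p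
    intro e he
    refine hcol e (hpR e he) ?_
    rintro rfl
    exact hnot he
  -- `b ↦ cramer M b j₀` is the determinant with column `j₀` replaced by `b`. It is linear and kills
  -- the other columns, so column `j₀` may be computed modulo `N`.
  have hker : N ≤ LinearMap.ker ((LinearMap.proj j₀).comp (Matrix.cramer M)) := by
    rw [hN, Submodule.span_le]
    rintro _ ⟨j, hj, rfl⟩
    simp only [SetLike.mem_coe, LinearMap.mem_ker, LinearMap.comp_apply, LinearMap.proj_apply,
      Matrix.cramer_apply]
    refine Matrix.det_zero_of_column_eq (Ne.symm hj) fun i => ?_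
    simp [Matrix.updateCol_ne hj, Matrix.col]
  have hdet : M.det = S v s(v, w) * (1 - walkWeight h (SimpleGraph.Walk.cons hvw p)) *
      (M.updateCol j₀ (unitVec R.verts v)).det := by
    have h0 := hker hwN
    simp only [LinearMap.mem_ker, LinearMap.comp_apply, LinearMap.proj_apply, map_sub,
      map_smul, smul_eq_mul] at h0
    have h1 : M.det = Matrix.cramer M (M.col j₀) j₀ := by
      rw [Matrix.cramer_apply]
      congr 1
      ext1 i j
      by_cases hj : j = j₀
      · subst hj
        simp [Matrix.col]
      · simp [Matrix.updateCol_ne hj]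
    have h2 : M.col j₀ = edgeVec S R.verts s(v, w) := by
      rw [hMcol, hj₀]
      simp
    rw [h1, h2, hS.edgeVec_eq _ hvw, ← Matrix.cramer_apply]
    simp only [map_sub, map_smul, Pi.sub_apply, Pi.smul_apply, smul_eq_mul, walkWeight,
      SimpleGraph.Walk.darts_cons, List.map_cons, List.prod_cons] at h0 ⊢
    linear_combination (-S v s(v, w) * h w v) * h0
  have hunit : IsUnit (M.updateCol j₀ (unitVec R.verts v)).det := by
    apply Matrix.isUnit_det_of_single_mem_span
    set N' := Submodule.span GaussianInt (Set.range (M.updateCol j₀ (unitVec R.verts v)).col)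
      with hN'
    have hNN : N ≤ N' := by
      rw [hN, Submodule.span_le]
      rintro _ ⟨j, hj, rfl⟩
      refine Submodule.subset_span ⟨j, ?_⟩
      ext1 i
      simp [Matrix.col, Matrix.updateCol_ne hj]
    have hv : unitVec R.verts v ∈ N' := by
      refine Submodule.subset_span ⟨j₀, ?_⟩
      ext1 i
      simp [Matrix.col]
    -- The column of `vw` is gone, but the rest of the cycle still leads from `v` to `w`, so the
    -- missing edge can be crossed.
    have hw : unitVec R.verts w ∈ N' := by
      simpa using N'.add_mem (hNN hwN) (N'.smul_mem (walkWeight h p) hv)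
    intro j
    rw [← unitVec_eq_single]
    refine hR.unitVec_mem hS (hends _ he0 v (by simp)) hv (fun e he => ?_) j.2
    by_cases hne : e = s(v, w)
    · right
      intro x hx
      rw [hne, Sym2.mem_iff] at hx
      rcases hx with rfl | rfl
      exacts [hv, hw]
    · exact Or.inl (hNN (hcol e he hne))
  have hSv : (S v s(v, w)).norm = 1 := by
    have := hS.mul_star_self hvw
    rw [← Zsqrtd.norm_eq_mul_conj] at this
    exact_mod_cast this
  rw [hdet, Zsqrtd.norm_mul, Zsqrtd.norm_mul, hSv,
    (Zsqrtd.norm_eq_one_iff' (by norm_num) _).2 hunit, one_mul, mul_one]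

end MixedGraph.Substructure

/-! ### Components and factorization of the Gram determinant -/

namespace MixedGraph.Substructure

section Component

variable {V : Type*} {G : MixedGraph V} {R : G.Substructure}

theorem incidenceGraph_adj_inl_inr {v : R.verts} {e : R.edges} (h : (v : V) ∈ (e : Sym2 V)) :
    R.incidenceGraph.Adj (Sum.inl v) (Sum.inr e) := by
  rw [incidenceGraph, SimpleGraph.fromRel_adj]
  exact ⟨by simp, Or.inl ⟨v, e, rfl, rfl, h⟩⟩

theorem component_eq_of_mem {v : R.verts} {e : R.edges} (h : (v : V) ∈ (e : Sym2 V)) :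
    R.incidenceGraph.connectedComponentMk (Sum.inl v) =
      R.incidenceGraph.connectedComponentMk (Sum.inr e) :=
  SimpleGraph.ConnectedComponent.eq.2 (incidenceGraph_adj_inl_inr h).reachable

theorem induction_of_reachable {P : R.verts ⊕ R.edges → Prop}
    (h1 : ∀ (v : R.verts) (e : R.edges), (v : V) ∈ (e : Sym2 V) → P (Sum.inl v) → P (Sum.inr e))
    (h2 : ∀ (v : R.verts) (e : R.edges), (v : V) ∈ (e : Sym2 V) → P (Sum.inr e) → P (Sum.inl v))
    {x y : R.verts ⊕ R.edges} (hxy : R.incidenceGraph.Reachable x y) (hx : P x) : P y := by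
  obtain ⟨p⟩ := hxy
  induction p with
  | nil => exact hx
  | cons hadj p ih =>
    apply ih
    rw [incidenceGraph, SimpleGraph.fromRel_adj] at hadj
    rcases hadj.2 with ⟨v, e, rfl, rfl, hve⟩ | ⟨v, e, rfl, rfl, hve⟩
    · exact h1 v e hve hx
    · exact h2 v e hve hx

/-- The hypothesis excludes a lone edge with both ends missing, which is a component without
vertices. -/
theorem isLinked_component {C : R.Component} (hne : (R.component C).verts.Nonempty) :
    (R.component C).IsLinked := by
  obtain ⟨u₀, hu₀, hu₀C⟩ := hne
  refine ⟨⟨u₀, hu₀, hu₀C⟩, ?_, ?_⟩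
  · rintro e ⟨he, heC⟩
    have hreach := SimpleGraph.ConnectedComponent.eq.1 (hu₀C.trans heC.symm)
    -- Trivial at vertices; at an edge, the last step of the path supplies an incident vertex of
    -- `R`.
    have key := induction_of_reachable (P := Sum.elim (fun _ => True)
      (fun e : R.edges => ∃ v ∈ R.verts, v ∈ (e : Sym2 V)))
      (fun v _ hve _ => ⟨v, v.2, hve⟩) (fun _ _ _ _ => trivial) hreach trivial
    obtain ⟨v, hv, hve⟩ : ∃ v ∈ R.verts, v ∈ e := key
    refine ⟨v, hve, hv, ?_⟩
    rw [← heC]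
    exact component_eq_of_mem (v := ⟨v, hv⟩) (e := ⟨e, he⟩) hve
  · rintro s ⟨u, ⟨hu, huC⟩, hus⟩ hs v ⟨hv, hvC⟩
    have hreach := SimpleGraph.ConnectedComponent.eq.1 (huC.trans hvC.symm)
    -- An edge satisfies the predicate when all its ends in `R` lie in `s`. Membership in `C` is
    -- carried along so that `hs` applies.
    have key := induction_of_reachable
      (P := fun x => R.incidenceGraph.connectedComponentMk x = C ∧
        Sum.elim (fun v : R.verts => (v : V) ∈ s)
          (fun e : R.edges => ∀ v ∈ (e : Sym2 V), v ∈ R.verts → v ∈ s) x) ?_ ?_ hreach ⟨huC, hus⟩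
    · exact key.2
    · rintro a e hae ⟨haC, has⟩
      have heC := (component_eq_of_mem hae).symm.trans haC
      exact ⟨heC, fun b hb hbR => hs e ⟨e.2, heC⟩ a hae b hb ⟨a.2, haC⟩
        ⟨hbR, (component_eq_of_mem (v := ⟨b, hbR⟩) hb).trans heC⟩ has⟩
    · rintro a e hae ⟨heC, hes⟩
      exact ⟨(component_eq_of_mem hae).trans heC, hes a hae a.2⟩

theorem verts_nonempty_or_edges_nonempty (C : R.Component) :
    (R.component C).verts.Nonempty ∨ (R.component C).edges.Nonempty := by
  induction C using SimpleGraph.ConnectedComponent.ind with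
  | h x =>
    rcases x with v | e
    · exact Or.inl ⟨v, v.2, rfl⟩
    · exact Or.inr ⟨e, e.2, rfl⟩

end Component

variable {V : Type*} [Fintype V] {G : MixedGraph V} (R : G.Substructure)

instance : Finite R.Component := by
  unfold Component SimpleGraph.ConnectedComponent
  infer_instance

noncomputable instance : Fintype R.Component := Fintype.ofFinite _

theorem sum_ncard_component_verts : ∑ C, (R.component C).verts.ncard = R.verts.ncard := by
  classical
  rw [← Nat.card_coe_set_eq, Nat.card_eq_fintype_card, ← Finset.card_univ,
    Finset.card_eq_sum_card_fiberwise (f := fun v : R.verts =>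
      R.incidenceGraph.connectedComponentMk (Sum.inl v)) (t := Finset.univ) (by simp)]
  refine Finset.sum_congr rfl fun C _ => ?_
  rw [← Set.ncard_coe_finset, ← Set.ncard_image_of_injective _ Subtype.val_injective]
  congr 1
  ext v
  simp [component]

theorem sum_ncard_component_edges : ∑ C, (R.component C).edges.ncard = R.edges.ncard := by
  classical
  rw [← Nat.card_coe_set_eq, Nat.card_eq_fintype_card, ← Finset.card_univ,
    Finset.card_eq_sum_card_fiberwise (f := fun e : R.edges =>
      R.incidenceGraph.connectedComponentMk (Sum.inr e)) (t := Finset.univ) (by simp)]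
  refine Finset.sum_congr rfl fun C _ => ?_
  rw [← Set.ncard_coe_finset, ← Set.ncard_image_of_injective _ Subtype.val_injective]
  congr 1
  ext v
  simp [component]

/-- An edge meeting two vertices of `R` puts them in one component, and an edge of one component has
zero entries at vertices of the others. So the Gram matrix is block diagonal. -/
theorem gramDet_eq_prod_component {S : V → Sym2 V → GaussianInt}
    (hS : ∀ {x : V} {e : Sym2 V}, x ∉ e → S x e = 0) :
    gramDet S R.verts R.edges =
      ∏ C, gramDet S (R.component C).verts (R.component C).edges := by
  classical
  -- Block triangularity needs some order on the blocks; any order serves for a block diagonal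
  -- matrix.
  let : LinearOrder R.Component := LinearOrder.lift' (Fintype.equivFin R.Component)
    (Equiv.injective _)
  set b : R.verts → R.Component := fun v => R.incidenceGraph.connectedComponentMk (Sum.inl v)
    with hb
  have hzero : ∀ (u : R.verts) (e : Sym2 V) (he : e ∈ R.edges),
      R.incidenceGraph.connectedComponentMk (Sum.inr ⟨e, he⟩) ≠ b u → S u e = 0 := by
    intro u e he hne
    exact hS fun hu => hne (component_eq_of_mem (v := u) (e := ⟨e, he⟩) hu).symm
  rw [gramDet, Matrix.BlockTriangular.det_fintype (b := b)]
  · refine Finset.prod_congr rfl fun C _ => ?_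
    rw [gramDet, ← Matrix.det_submatrix_equiv_self (n := (R.component C).verts)
      (m := {v : R.verts // b v = C})
      ⟨fun v => ⟨⟨v, v.2.1⟩, v.2.2⟩, fun v => ⟨v, v.1.2, v.2⟩, fun _ => rfl, fun _ => rfl⟩]
    congr 1
    ext1 u v
    simp only [Matrix.toSquareBlock_def, Matrix.submatrix_apply, Matrix.of_apply, Equiv.coe_fn_mk]
    symm
    apply Finset.sum_subset
    · intro e he
      rw [Set.mem_toFinset] at he ⊢
      exact he.1
    · intro e he he'
      rw [Set.mem_toFinset] at he he'
      rw [hzero ⟨u, u.2.1⟩ e he, zero_mul]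
      intro h
      exact he' ⟨he, h.trans u.2.2⟩
  · intro u v huv
    rw [Matrix.of_apply]
    refine Finset.sum_eq_zero fun e he => ?_
    rw [Set.mem_toFinset] at he
    by_cases h : R.incidenceGraph.connectedComponentMk (Sum.inr ⟨e, he⟩) = b u
    · rw [hzero v e he, star_zero, mul_zero]
      rw [h]
      exact huv.ne'
    · rw [hzero u e he h, zero_mul]

end MixedGraph.Substructure

/-! ### Recognizing rootless trees and unicyclic graphs by counting -/

theorem SimpleGraph.Subgraph.exists_walk_map_hom_eq {V : Type*} {K : SimpleGraph V}
    (H : K.Subgraph) {u v : V} (p : K.Walk u v) (hp : ∀ e ∈ p.edges, e ∈ H.edgeSet)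
    (hu : u ∈ H.verts) (hv : v ∈ H.verts) :
    ∃ q : H.coe.Walk ⟨u, hu⟩ ⟨v, hv⟩, q.map H.hom = p := by
  induction p with
  | nil => exact ⟨SimpleGraph.Walk.nil, rfl⟩
  | @cons u w v huw p ih =>
    simp only [SimpleGraph.Walk.edges_cons, List.mem_cons, forall_eq_or_imp] at hp
    have hadj : H.Adj u w := hp.1
    obtain ⟨q, hq⟩ := ih hp.2 hadj.snd_mem hv
    exact ⟨SimpleGraph.Walk.cons (show H.coe.Adj ⟨u, hu⟩ ⟨w, hadj.snd_mem⟩ from hadj) q,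
      by subst hq; rfl⟩

theorem SimpleGraph.Subgraph.ncard_edgeSet_eq {V : Type*} {K : SimpleGraph V} (H : K.Subgraph) :
    Nat.card H.coe.edgeSet = H.edgeSet.ncard := by
  rw [← H.image_coe_edgeSet_coe, Set.ncard_image_of_injective _
    (Sym2.map.injective Subtype.val_injective), Nat.card_coe_set_eq]

theorem SimpleGraph.Subgraph.exists_isCycle_coe {V : Type*} {K : SimpleGraph V}
    (H : K.Subgraph) {u : V} {c : K.Walk u u} (hc : c.IsCycle)
    (hcH : ∀ e ∈ c.edges, e ∈ H.edgeSet) :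
    ∃ (w : H.verts) (q : H.coe.Walk w w), q.IsCycle ∧
      c.edges = q.edges.map (Sym2.map Subtype.val) := by
  have hu : u ∈ H.verts := by
    cases c with
    | nil => exact absurd rfl hc.ne_nil
    | @cons _ w _ h p =>
      exact SimpleGraph.Subgraph.Adj.fst_mem (H := H) (v := w) (hcH s(u, w) (by simp))
  obtain ⟨q, rfl⟩ := H.exists_walk_map_hom_eq c hcH hu hu
  refine ⟨_, q, ?_, SimpleGraph.Walk.edges_map _ _⟩
  exact (SimpleGraph.Walk.isCycle_map_iff_of_injective H.hom_injective).1 hc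

namespace MixedGraph.Substructure

variable {V : Type*} {G : MixedGraph V} {R : G.Substructure}

/-- The subgraph formed by the vertices of `R` and the edges of `R` together with their ends. -/
def support (R : G.Substructure) : G.graph.Subgraph where
  verts := R.verts ∪ {v | ∃ e ∈ R.edges, v ∈ e}
  Adj u v := s(u, v) ∈ R.edges
  adj_sub := fun h => R.edges_subset h
  edge_vert := fun h => Or.inr ⟨_, h, by simp⟩
  symm := ⟨fun u v h => by rwa [Sym2.eq_swap]⟩

theorem edgeSet_support : R.support.edgeSet = R.edges := by
  ext e
  induction e with
  | h u v => rfl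

theorem verts_support_eq (hends : ∀ e ∈ R.edges, ∀ x ∈ e, x ∈ R.verts) :
    R.support.verts = R.verts :=
  Set.union_eq_left.2 fun _ ⟨e, he, hv⟩ => hends e he _ hv

/-- Linking connects the vertices of `R`; any further vertex is an end of an edge which also has an
end in `R`. -/
theorem IsLinked.connected_support (hR : R.IsLinked) : R.support.coe.Connected := by
  obtain ⟨u, hu⟩ := hR.nonempty
  have hu' : u ∈ R.support.verts := Or.inl hu
  have hstep : ∀ e ∈ R.edges, ∀ x ∈ e, ∀ y ∈ e,
      (∃ h : x ∈ R.support.verts, R.support.coe.Reachable ⟨u, hu'⟩ ⟨x, h⟩) →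
      ∃ h : y ∈ R.support.verts, R.support.coe.Reachable ⟨u, hu'⟩ ⟨y, h⟩ := by
    rintro e he x hx y hy ⟨hxH, hreach⟩
    by_cases hxy : x = y
    · subst hxy
      exact ⟨hxH, hreach⟩
    · rw [(Sym2.mem_and_mem_iff hxy).1 ⟨hx, hy⟩] at he
      have hadj : R.support.Adj x y := he
      exact ⟨hadj.snd_mem, hreach.trans
        (SimpleGraph.Adj.reachable (show R.support.coe.Adj ⟨x, hxH⟩ ⟨y, hadj.snd_mem⟩ from hadj))⟩
  have hX := hR.subset_of_closed
    {v | ∃ h : v ∈ R.support.verts, R.support.coe.Reachable ⟨u, hu'⟩ ⟨v, h⟩}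
    ⟨u, hu, hu', SimpleGraph.Reachable.refl _⟩
    (fun e he x hx y hy _ _ => hstep e he x hx y hy)
  refine (SimpleGraph.connected_iff_exists_forall_reachable _).2 ⟨⟨u, hu'⟩, ?_⟩
  rintro ⟨v, hv⟩
  rcases id hv with hvR | ⟨e, he, hve⟩
  · exact (hX hvR).2
  · obtain ⟨w, hwe, hwR⟩ := hR.exists_mem e he
    exact (hstep e he w hwe v hve (hX hwR)).2

theorem IsLinked.ncard_verts_support_le (hR : R.IsLinked) :
    R.support.verts.ncard ≤ R.edges.ncard + 1 := by
  have := hR.connected_support.card_vert_le_card_edgeSet_add_one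
  rwa [SimpleGraph.Subgraph.ncard_edgeSet_eq, edgeSet_support, Nat.card_coe_set_eq] at this

theorem IsUnicyclic.mem_verts (hR : R.IsUnicyclic) : ∀ e ∈ R.edges, ∀ x ∈ e, x ∈ R.verts := by
  obtain ⟨⟨H, -, hX, hY⟩, -⟩ := hR
  intro e he x hx
  rw [hX]
  rw [hY] at he
  exact H.mem_verts_of_mem_edge he hx

theorem IsRootlessTree.exists_notMem_verts (hR : R.IsRootlessTree) (hne : R.verts.Nonempty) :
    ∃ e ∈ R.edges, ∃ z ∈ e, z ∉ R.verts := by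
  obtain ⟨T, hT, r, hr, hX, hY⟩ := hR
  obtain ⟨x, hx⟩ := hne
  rw [hX] at hx
  obtain ⟨p⟩ := hT.connected.preconnected ⟨r, hr⟩ ⟨x, hx.1⟩
  cases p with
  | nil => exact absurd rfl hx.2
  | @cons _ w _ h p =>
    refine ⟨s(r, w), ?_, r, by simp, ?_⟩
    · rw [hY]
      exact h
    · rw [hX]
      simp

variable [Finite V]

theorem IsRootlessTree.ncard_verts_le (hR : R.IsRootlessTree) :
    R.verts.ncard ≤ R.edges.ncard := by
  obtain ⟨T, hT, r, hr, hX, hY⟩ := hR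
  have h1 := (SimpleGraph.isTree_iff_connected_and_card.1 hT).2
  rw [SimpleGraph.Subgraph.ncard_edgeSet_eq, Nat.card_coe_set_eq, ← hY] at h1
  rw [hX, Set.ncard_sdiff_singleton_of_mem hr]
  omega

theorem IsUnicyclic.ncard_verts_le (hR : R.IsUnicyclic) : R.verts.ncard ≤ R.edges.ncard := by
  obtain ⟨⟨H, hH, hX, hY⟩, ⟨v, c, hc, hcR⟩, -⟩ := hR
  have h1 := hH.card_vert_le_card_edgeSet_add_one
  have h2 : ¬ Nat.card H.coe.edgeSet + 1 = Nat.card H.verts := by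
    intro h
    have hT := SimpleGraph.isTree_iff_connected_and_card.2 ⟨hH, h⟩
    obtain ⟨w, q, hq, -⟩ := H.exists_isCycle_coe hc (by rwa [← hY])
    exact hT.isAcyclic q hq
  rw [SimpleGraph.Subgraph.ncard_edgeSet_eq, Nat.card_coe_set_eq, ← hY, ← hX] at h1 h2
  omega

/-- The support is connected, so it has at most `|edges| + 1 = |verts| + 1` vertices. Hence `z` is
the only vertex outside `R`, and equality forces a tree. -/
theorem IsLinked.isRootlessTree (hR : R.IsLinked) (hsq : R.IsSquare) {e : Sym2 V}
    (he : e ∈ R.edges) {z : V} (hz : z ∈ e) (hzR : z ∉ R.verts) : R.IsRootlessTree := by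
  have hzH : z ∈ R.support.verts := Or.inr ⟨e, he, hz⟩
  have hcard : (insert z R.verts).ncard = R.verts.ncard + 1 := Set.ncard_insert_of_notMem hzR
  have hsub : insert z R.verts ⊆ R.support.verts :=
    Set.insert_subset hzH Set.subset_union_left
  have hle := hR.ncard_verts_support_le
  rw [← hsq] at hle
  have hX : insert z R.verts = R.support.verts := Set.eq_of_subset_of_ncard_le hsub (by omega)
  refine ⟨R.support, ?_, z, hzH, ?_, edgeSet_support.symm⟩
  · refine SimpleGraph.isTree_iff_connected_and_card.2 ⟨hR.connected_support, ?_⟩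
    rw [SimpleGraph.Subgraph.ncard_edgeSet_eq, edgeSet_support, Nat.card_coe_set_eq, ← hX, hcard,
      hsq]
  · rw [← hX, Set.insert_sdiff_self_of_notMem hzR]

/-- The support is connected with as many edges as vertices, so it is not a tree and has a cycle. If
an edge of one cycle were missing from another, deleting it would leave a connected graph with one
edge fewer than vertices, a tree, still containing the second cycle. -/
theorem IsLinked.isUnicyclic (hR : R.IsLinked) (hsq : R.IsSquare)
    (hends : ∀ e ∈ R.edges, ∀ x ∈ e, x ∈ R.verts) : R.IsUnicyclic := by
  have hconn := hR.connected_support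
  have hV : Nat.card R.support.verts = R.verts.ncard := by
    rw [Nat.card_coe_set_eq, verts_support_eq hends]
  have hE : Nat.card R.support.coe.edgeSet = R.verts.ncard := by
    rw [SimpleGraph.Subgraph.ncard_edgeSet_eq, edgeSet_support, hsq]
  have hsub : ∀ (u v : V) (c : G.graph.Walk u u) (c' : G.graph.Walk v v),
      R.HasCycle c → R.HasCycle c' → ∀ e, e ∈ c.edges → e ∈ c'.edges := by
    rintro u v c c' ⟨hc, hcR⟩ ⟨hc', hcR'⟩ e he
    obtain ⟨w, q, hq, hqe⟩ := R.support.exists_isCycle_coe hc (by rwa [edgeSet_support])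
    obtain ⟨w', q', hq', hqe'⟩ := R.support.exists_isCycle_coe hc' (by rwa [edgeSet_support])
    by_contra hne
    rw [hqe, List.mem_map] at he
    obtain ⟨f, hf, rfl⟩ := he
    have hf' : f ∉ q'.edges := fun h => hne (by rw [hqe']; exact List.mem_map_of_mem h)
    induction f with
    | h x y =>
    have hbr : ¬ R.support.coe.IsBridge s(x, y) := fun h => h.notMem_edges_of_isCycle hq hf
    have hdel := hconn.connected_delete_edge_of_not_isBridge hbr
    have hcard : Nat.card (R.support.coe.deleteEdges {s(x, y)}).edgeSet + 1 =
        Nat.card R.support.verts := by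
      rw [hV, ← hE, SimpleGraph.edgeSet_deleteEdges, Nat.card_coe_set_eq, Nat.card_coe_set_eq]
      exact Set.ncard_sdiff_singleton_add_one (q.edges_subset_edgeSet hf)
    have hT := SimpleGraph.isTree_iff_connected_and_card.2 ⟨hdel, hcard⟩
    refine hT.isAcyclic (q'.toDeleteEdges {s(x, y)} ?_) (hq'.transfer _)
    rintro g hg rfl
    exact hf' hg
  refine ⟨⟨R.support, hconn, (verts_support_eq hends).symm, edgeSet_support.symm⟩, ?_,
    fun u v c c' hc hc' e => ⟨hsub u v c c' hc hc' e, hsub v u c' c hc' hc e⟩⟩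
  have hnot : ¬ R.support.coe.IsAcyclic := by
    intro h
    have := (SimpleGraph.isTree_iff_connected_and_card.1 ⟨hconn, h⟩).2
    omega
  simp only [SimpleGraph.IsAcyclic, not_forall, not_not] at hnot
  obtain ⟨w, q, hq⟩ := hnot
  refine ⟨R.support.hom w, q.map R.support.hom, hq.map R.support.hom_injective, ?_⟩
  intro e he
  rw [SimpleGraph.Walk.edges_map, List.mem_map] at he
  obtain ⟨f, hf, rfl⟩ := he
  rw [← edgeSet_support, ← R.support.image_coe_edgeSet_coe]
  exact ⟨f, q.edges_subset_edgeSet hf, rfl⟩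

end MixedGraph.Substructure

/-! ### Gaussian weights and cycle types -/

namespace MixedGraph

section Weights

variable {V : Type*} (G : MixedGraph V)

open Classical in
/-- The Hermitian adjacency matrix with entries in the Gaussian integers. -/
noncomputable def gaussianAdjacency (u v : V) : GaussianInt :=
  if G.arc u v then ⟨0, 1⟩
  else if G.arc v u then ⟨0, -1⟩
  else if G.graph.Adj u v then 1
  else 0

theorem toComplex_gaussianAdjacency (u v : V) :
    (G.gaussianAdjacency u v : ℂ) = G.hermitianAdjacency u v := by
  rw [gaussianAdjacency, hermitianAdjacency, Matrix.of_apply]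
  split_ifs <;> simp [GaussianInt.toComplex_def']

theorem star_gaussianAdjacency (u v : V) :
    star (G.gaussianAdjacency u v) = G.gaussianAdjacency v u := by
  by_cases h1 : G.arc u v
  · simp [gaussianAdjacency, h1, G.arc_asymm h1]
  by_cases h2 : G.arc v u
  · simp [gaussianAdjacency, h1, h2]
  by_cases h3 : G.graph.Adj u v
  · simp [gaussianAdjacency, h1, h2, h3, h3.symm]
  · simp [gaussianAdjacency, h1, h2, h3, mt SimpleGraph.Adj.symm h3]

theorem gaussianAdjacency_mul_star {u v : V} (h : G.graph.Adj u v) :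
    G.gaussianAdjacency u v * star (G.gaussianAdjacency u v) = 1 := by
  unfold gaussianAdjacency
  split_ifs <;> rfl

theorem gaussianAdjacency_eq_zero {u v : V} (h : ¬ G.graph.Adj u v) :
    G.gaussianAdjacency u v = 0 := by
  rw [gaussianAdjacency, if_neg (mt G.arc_adj h), if_neg (fun h' => h (G.arc_adj h').symm),
    if_neg h]

open Classical in
/-- An incidence matrix of a mixed graph. -/
noncomputable def incidence (x : V) (e : Sym2 V) : GaussianInt :=
  if x ∉ e then 0 else if x = (Quot.out e).1 then 1 else -G.gaussianAdjacency x (Quot.out e).1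

/-- `Quot.out` picks a reference end of each edge, with entry 1. As `h` is Hermitian, the product
for `u`, `v` is `-h u v` whichever end is picked. -/
theorem isIncidence : G.IsIncidence G.gaussianAdjacency G.incidence := by
  have hout : ∀ u v : V, (Quot.out s(u, v)).1 = u ∨ (Quot.out s(u, v)).1 = v := by
    intro u v
    have h : s((Quot.out s(u, v)).1, (Quot.out s(u, v)).2) = s(u, v) := Quot.out_eq _
    rcases Sym2.eq_iff.1 h with h | h
    exacts [Or.inl h.1, Or.inr h.1]
  refine ⟨fun h => if_pos h, ?_, ?_⟩
  · intro u v huv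
    rcases hout u v with h | h
    · simp [incidence, h]
    · simp [incidence, h, huv.ne, G.gaussianAdjacency_mul_star huv]
  · intro u v huv
    rcases hout u v with h | h
    · simp [incidence, h, huv.ne', star_gaussianAdjacency]
    · simp [incidence, h, huv.ne]

/-- Because the weight is read backwards, an edge oriented along the walk contributes `-i` and one
oriented against it `i`. -/
theorem walkWeight_gaussianAdjacency {v : V} (c : G.graph.Walk v v) :
    walkWeight G.gaussianAdjacency c = (⟨0, -1⟩ : GaussianInt) ^ forwardCount c *
      (⟨0, 1⟩ : GaussianInt) ^ backwardCount c := by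
  classical
  rw [walkWeight, forwardCount, backwardCount]
  induction c.darts with
  | nil => simp
  | cons d l ih =>
    rw [List.map_cons, List.prod_cons, ih, List.countP_cons, List.countP_cons]
    by_cases h1 : G.arc d.fst d.snd
    · have h2 := G.arc_asymm h1
      simp only [gaussianAdjacency, h1, h2, if_true, if_false, decide_true, decide_false,
        Bool.false_eq_true, pow_succ, add_zero]
      ring
    by_cases h2 : G.arc d.snd d.fst
    · simp only [gaussianAdjacency, h1, h2, if_true, if_false, decide_true, decide_false,
        Bool.false_eq_true, pow_succ, add_zero]
      ring
    · simp [gaussianAdjacency, h1, h2, d.adj.symm]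

variable {G} {v : V} {c : G.graph.Walk v v}

/-- `±i` are fourth roots of unity, so only the counts modulo 4 matter and each type becomes a
finite check. -/
theorem norm_one_sub_walkWeight (c : G.graph.Walk v v) :
    (1 - walkWeight G.gaussianAdjacency c).norm =
      (1 - (⟨0, -1⟩ : GaussianInt) ^ (forwardCount c % 4) *
        (⟨0, 1⟩ : GaussianInt) ^ (backwardCount c % 4)).norm := by
  rw [walkWeight_gaussianAdjacency, pow_eq_pow_mod _ (n := 4) (by rfl),
    pow_eq_pow_mod (backwardCount c) (n := 4) (by rfl)]

theorem TypeI.norm_one_sub_walkWeight (hc : TypeI c) :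
    (1 - walkWeight G.gaussianAdjacency c).norm = 2 := by
  rw [MixedGraph.norm_one_sub_walkWeight]
  obtain ⟨m, hm⟩ := hc
  have h : (forwardCount c % 4 + backwardCount c % 4) % 2 = 1 := by omega
  have ha := Nat.mod_lt (forwardCount c) (show 4 > 0 by norm_num)
  have hb := Nat.mod_lt (backwardCount c) (show 4 > 0 by norm_num)
  generalize forwardCount c % 4 = a at *
  generalize backwardCount c % 4 = b at *
  interval_cases a <;> interval_cases b <;> first | rfl | omega

theorem TypeIV.norm_one_sub_walkWeight (hc : TypeIV c) :
    (1 - walkWeight G.gaussianAdjacency c).norm = 4 := by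
  rw [MixedGraph.norm_one_sub_walkWeight]
  obtain ⟨k, ⟨m, rfl⟩, hm⟩ := hc
  have h : (forwardCount c % 4 + backwardCount c % 4) % 2 = 0 ∧
      (forwardCount c % 4 + 2) % 4 = backwardCount c % 4 := by
    rcases abs_cases ((forwardCount c : ℤ) - backwardCount c) with h | h <;> omega
  have ha := Nat.mod_lt (forwardCount c) (show 4 > 0 by norm_num)
  have hb := Nat.mod_lt (backwardCount c) (show 4 > 0 by norm_num)
  generalize forwardCount c % 4 = a at *
  generalize backwardCount c % 4 = b at *
  interval_cases a <;> interval_cases b <;> first | rfl | omega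

theorem TypeV.norm_one_sub_walkWeight (hc : TypeV c) :
    (1 - walkWeight G.gaussianAdjacency c).norm = 0 := by
  rw [MixedGraph.norm_one_sub_walkWeight]
  obtain ⟨k, ⟨m, rfl⟩, hm⟩ := hc
  have h : forwardCount c % 4 = backwardCount c % 4 := by
    rcases abs_cases ((forwardCount c : ℤ) - backwardCount c) with h | h <;> omega
  have hb := Nat.mod_lt (backwardCount c) (show 4 > 0 by norm_num)
  rw [h]
  generalize backwardCount c % 4 = b at *
  interval_cases b <;> rfl

theorem typeI_or_typeIV_or_typeV (c : G.graph.Walk v v) : TypeI c ∨ TypeIV c ∨ TypeV c := by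
  by_cases h : Odd (forwardCount c + backwardCount c)
  · exact Or.inl h
  · right
    rw [Nat.not_odd_iff_even] at h
    obtain ⟨m, hm⟩ := h
    obtain ⟨k, hk⟩ : ∃ k : ℤ, |(forwardCount c : ℤ) - backwardCount c| = 2 * k := by
      refine ⟨|(forwardCount c : ℤ) - backwardCount c| / 2, ?_⟩
      rcases abs_cases ((forwardCount c : ℤ) - backwardCount c) with h | h <;> omega
    rcases Int.even_or_odd k with hk' | hk'
    exacts [Or.inr ⟨k, hk', hk⟩, Or.inl ⟨k, hk', hk⟩]

end Weights

variable {V : Type*} [Fintype V] {G : MixedGraph V}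

/-! ### Super special substructures are exactly the nonzero square terms -/

namespace Substructure

open Classical in
/-- The contribution of a component to the weight of a super special substructure. -/
noncomputable def cycleExponent (R : G.Substructure) : ℕ :=
  (if R.IsUnicyclicTypeI then 1 else 0) + 2 * (if R.IsUnicyclicTypeIV then 1 else 0)

theorem sum_cycleExponent_component (R : G.Substructure) :
    ∑ C, (R.component C).cycleExponent = R.numTypeI + 2 * R.numTypeIV := by
  classical
  simp only [cycleExponent, Finset.sum_add_distrib, ← Finset.mul_sum, Finset.sum_boole, numTypeI,
    numTypeIV]
  simp [← Set.ncard_coe_finset]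

theorem IsLinked.gramDet_incidence {R : G.Substructure} (hR : R.IsLinked) (hsq : R.IsSquare)
    (hgood : R.IsRootlessTree ∨ (R.IsUnicyclic ∧ ¬ R.IsUnicyclicTypeV)) :
    gramDet G.incidence R.verts R.edges = 2 ^ R.cycleExponent := by
  by_cases hends : ∀ e ∈ R.edges, ∀ x ∈ e, x ∈ R.verts
  · have hU : R.IsUnicyclic ∧ ¬ R.IsUnicyclicTypeV := by
      refine hgood.resolve_left fun hT => ?_
      obtain ⟨e, he, z, hz, hzR⟩ := hT.exists_notMem_verts hR.nonempty
      exact hzR (hends e he z hz)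
    have key : ∀ (v : V) (c : G.graph.Walk v v), R.HasCycle c →
        gramDet G.incidence R.verts R.edges =
          ((1 - walkWeight G.gaussianAdjacency c).norm : GaussianInt) := fun v c hc =>
      hR.gramDet_eq_norm_one_sub hsq G.isIncidence hends hc
    have hI : R.IsUnicyclicTypeI → gramDet G.incidence R.verts R.edges = (2 : ℤ) := by
      rintro ⟨-, v, c, hc, hct⟩
      rw [key v c hc, hct.norm_one_sub_walkWeight]
    have hIV : R.IsUnicyclicTypeIV → gramDet G.incidence R.verts R.edges = (4 : ℤ) := by
      rintro ⟨-, v, c, hc, hct⟩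
      rw [key v c hc, hct.norm_one_sub_walkWeight]
    -- The two types could be witnessed by different walks, but every walk around the cycle
    -- evaluates the same determinant, and 2 ≠ 4.
    have hnot : ¬ (R.IsUnicyclicTypeI ∧ R.IsUnicyclicTypeIV) := by
      rintro ⟨h1, h2⟩
      have h := (hI h1).symm.trans (hIV h2)
      rw [Int.cast_inj] at h
      norm_num at h
    obtain ⟨v, c, hc⟩ := hU.1.2.1
    rcases typeI_or_typeIV_or_typeV c with h | h | h
    · have h1 : R.IsUnicyclicTypeI := ⟨hU.1, v, c, hc, h⟩
      have h2 : ¬ R.IsUnicyclicTypeIV := fun h2 => hnot ⟨h1, h2⟩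
      rw [hI h1, cycleExponent, if_pos h1, if_neg h2]
      norm_num
    · have h2 : R.IsUnicyclicTypeIV := ⟨hU.1, v, c, hc, h⟩
      have h1 : ¬ R.IsUnicyclicTypeI := fun h1 => hnot ⟨h1, h2⟩
      rw [hIV h2, cycleExponent, if_neg h1, if_pos h2]
      norm_num
    · exact absurd ⟨hU.1, v, c, hc, h⟩ hU.2
  · have hU : ¬ R.IsUnicyclic := fun hU => hends hU.mem_verts
    push Not at hends
    obtain ⟨e, he, z, hz, hzR⟩ := hends
    rw [hR.gramDet_eq_one hsq G.isIncidence he hz hzR, cycleExponent, if_neg (fun h => hU h.1),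
      if_neg (fun h => hU h.1)]
    norm_num

theorem IsLinked.isRootlessTree_or_isUnicyclic {R : G.Substructure} (hR : R.IsLinked)
    (hsq : R.IsSquare) (hne : gramDet G.incidence R.verts R.edges ≠ 0) :
    R.IsRootlessTree ∨ (R.IsUnicyclic ∧ ¬ R.IsUnicyclicTypeV) := by
  by_cases hends : ∀ e ∈ R.edges, ∀ x ∈ e, x ∈ R.verts
  · refine Or.inr ⟨hR.isUnicyclic hsq hends, ?_⟩
    rintro ⟨-, v, c, hc, hct⟩
    apply hne
    rw [hR.gramDet_eq_norm_one_sub hsq G.isIncidence hends hc, hct.norm_one_sub_walkWeight,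
      Int.cast_zero]
  · push Not at hends
    obtain ⟨e, he, z, hz, hzR⟩ := hends
    exact Or.inl (hR.isRootlessTree hsq he hz hzR)

/-- The termwise inequalities sum to an equality. They come from the shape of the components for
super special `R`, and from nonvanishing of the determinants in the converse. -/
theorem isSquare_component {R : G.Substructure} (hsq : R.IsSquare)
    (hle : ∀ C : R.Component, (R.component C).verts.ncard ≤ (R.component C).edges.ncard)
    (C : R.Component) : (R.component C).IsSquare := by
  refine (Finset.sum_eq_sum_iff_of_le fun C _ => hle C).1 ?_ C (Finset.mem_univ C)
  rw [sum_ncard_component_verts, sum_ncard_component_edges, hsq]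

theorem isLinked_component_of_isSquare {R : G.Substructure} {C : R.Component}
    (hsq : (R.component C).IsSquare) : (R.component C).IsLinked := by
  refine isLinked_component ?_
  rw [← Set.ncard_pos]
  rcases verts_nonempty_or_edges_nonempty C with h | h
  · rwa [Set.ncard_pos]
  · rw [hsq, Set.ncard_pos]
    exact h

theorem IsSuperSpecial.gramDet_incidence {R : G.Substructure} (hR : R.IsSuperSpecial) :
    gramDet G.incidence R.verts R.edges = 2 ^ (R.numTypeI + 2 * R.numTypeIV) := by
  have hsq : ∀ C, (R.component C).IsSquare := by
    refine isSquare_component hR.1 fun C => ?_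
    rcases hR.2 C with h | h
    exacts [h.ncard_verts_le, h.1.ncard_verts_le]
  rw [gramDet_eq_prod_component R G.isIncidence.eq_zero, ← sum_cycleExponent_component,
    ← Finset.prod_pow_eq_pow_sum]
  exact Finset.prod_congr rfl fun C _ =>
    (isLinked_component_of_isSquare (hsq C)).gramDet_incidence (hsq C) (hR.2 C)

theorem IsSquare.isSuperSpecial_of_gramDet_ne_zero {R : G.Substructure} (hR : R.IsSquare)
    (hne : gramDet G.incidence R.verts R.edges ≠ 0) : R.IsSuperSpecial := by
  rw [gramDet_eq_prod_component R G.isIncidence.eq_zero, Finset.prod_ne_zero_iff] at hne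
  have hsq : ∀ C, (R.component C).IsSquare := by
    refine isSquare_component hR fun C => ?_
    by_contra! h
    exact hne C (Finset.mem_univ C) (gramDet_eq_zero_of_ncard_lt _ h)
  exact ⟨hR, fun C => (isLinked_component_of_isSquare (hsq C)).isRootlessTree_or_isUnicyclic
    (hsq C) (hne C (Finset.mem_univ C))⟩

end Substructure

/-! ### The factorization of the Laplacian and the final sum -/

open Classical in
-- On the diagonal each incident edge contributes 1, giving the degree; off the diagonal only the
-- edge `uv` can contribute, namely `-h u v`.
theorem hermitianLaplacian_apply [DecidableEq V] (u v : V) :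
    G.hermitianLaplacian u v = GaussianInt.toComplex
      (∑ e ∈ G.graph.edgeSet.toFinset, G.incidence u e * star (G.incidence v e)) := by
  have hS := G.isIncidence
  by_cases huv : u = v
  · subst huv
    have h1 : ∀ e ∈ G.graph.edgeSet.toFinset, G.incidence u e * star (G.incidence u e) =
        if u ∈ e then 1 else 0 := by
      intro e he
      split_ifs with hu
      · obtain ⟨w, rfl⟩ := Sym2.mem_iff_exists.1 hu
        exact hS.mul_star_self (by simpa using he)
      · rw [hS.eq_zero hu, zero_mul]
    rw [Finset.sum_congr rfl h1, Finset.sum_boole, map_natCast, hermitianLaplacian,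
      Matrix.sub_apply, Matrix.diagonal_apply_eq, ← toComplex_gaussianAdjacency,
      gaussianAdjacency_eq_zero _ G.graph.irrefl, map_zero, sub_zero,
      ← SimpleGraph.card_incidenceFinset_eq_degree]
    congr 2
    ext e
    simp [SimpleGraph.incidenceSet]
  · rw [hermitianLaplacian, Matrix.sub_apply, Matrix.diagonal_apply_ne _ huv,
      ← toComplex_gaussianAdjacency, zero_sub, ← map_neg]
    congr 1
    have h1 : ∀ e, e ≠ s(u, v) → G.incidence u e * star (G.incidence v e) = 0 := by
      intro e he
      by_cases hu : u ∈ e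
      · rw [hS.eq_zero (x := v) (fun hv => he ((Sym2.mem_and_mem_iff huv).1 ⟨hu, hv⟩)), star_zero,
          mul_zero]
      · rw [hS.eq_zero hu, zero_mul]
    by_cases hadj : G.graph.Adj u v
    · rw [Finset.sum_eq_single s(u, v) (fun e _ he => h1 e he) (fun h => absurd (by simpa) h),
        hS.mul_star hadj]
    · rw [gaussianAdjacency_eq_zero _ hadj, neg_zero]
      refine (Finset.sum_eq_zero fun e he => h1 e ?_).symm
      rintro rfl
      exact hadj (by simpa using he)

theorem det_hermitianLaplacian_submatrix [DecidableEq V] (W : Finset V) :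
    (G.hermitianLaplacian.submatrix
        (Subtype.val : {v // v ∈ W} → V) (Subtype.val : {v // v ∈ W} → V)).det =
      GaussianInt.toComplex (gramDet G.incidence W G.graph.edgeSet) := by
  classical
  rw [gramDet_eq_det_of_equiv G.incidence (X := (W : Set V)) (ι := {v // v ∈ W})
    (Equiv.subtypeEquivRight fun v => by simp) (Set.coe_toFinset G.graph.edgeSet),
    RingHom.map_det]
  congr 1
  ext1 u v
  exact hermitianLaplacian_apply _ _

theorem gramDet_edgeSet_eq_sum (W : Finset V) :
    gramDet G.incidence W G.graph.edgeSet =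
      ∑ R ∈ G.superSpecialOn W, gramDet G.incidence R.verts R.edges := by
  classical
  have hexp : gramDet G.incidence W G.graph.edgeSet =
      ∑ Y ∈ G.graph.edgeSet.toFinset.powersetCard W.card, gramDet G.incidence W Y := by
    rw [← Set.ncard_coe_finset W, ← gramDet_eq_sum_powersetCard, Set.coe_toFinset]
  rw [hexp]
  symm
  -- Only edge sets with a nonzero term need a preimage, and those give super special substructures.
  refine Finset.sum_bij_ne_zero (fun R _ _ => R.edges.toFinset) ?_ ?_ ?_ ?_
  · intro R hR _
    simp only [superSpecialOn, Set.Finite.mem_toFinset, Set.mem_ofPred_eq] at hR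
    rw [Finset.mem_powersetCard, Set.toFinset_subset_toFinset, ← Set.ncard_eq_toFinset_card',
      ← hR.1.1, hR.2, Set.ncard_coe_finset]
    exact ⟨R.edges_subset, rfl⟩
  · intro R hR _ R' hR' _ h
    simp only [superSpecialOn, Set.Finite.mem_toFinset, Set.mem_ofPred_eq] at hR hR'
    exact Substructure.ext (hR.2.trans hR'.2.symm) (Set.toFinset_inj.1 h)
  · intro Y hY hne
    rw [Finset.mem_powersetCard] at hY
    have hsub : (Y : Set (Sym2 V)) ⊆ G.graph.edgeSet := by
      intro e he
      simpa using hY.1 he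
    let R : G.Substructure := ⟨W, Y, hsub⟩
    have hsq : R.IsSquare := by
      change (W : Set V).ncard = (Y : Set (Sym2 V)).ncard
      rw [Set.ncard_coe_finset, Set.ncard_coe_finset, hY.2]
    refine ⟨R, ?_, hne, Finset.ext fun e => by simp [R]⟩
    simp only [superSpecialOn, Set.Finite.mem_toFinset, Set.mem_ofPred_eq]
    exact ⟨hsq.isSuperSpecial_of_gramDet_ne_zero hne, rfl⟩
  · intro R hR _
    simp only [superSpecialOn, Set.Finite.mem_toFinset, Set.mem_ofPred_eq] at hR
    rw [← hR.2, Set.coe_toFinset]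

end MixedGraph

theorem mainTheorem2 {V : Type*} [Fintype V] [DecidableEq V] (G : MixedGraph V) (W : Finset V) :
    (G.hermitianLaplacian.submatrix
        (Subtype.val : {v // v ∈ W} → V) (Subtype.val : {v // v ∈ W} → V)).det =
      ∑ R ∈ G.superSpecialOn W, (2 : ℂ) ^ (R.numTypeI + 2 * R.numTypeIV) := by
  rw [MixedGraph.det_hermitianLaplacian_submatrix, MixedGraph.gramDet_edgeSet_eq_sum, map_sum]
  refine Finset.sum_congr rfl fun R hR => ?_
  simp only [MixedGraph.superSpecialOn, Set.Finite.mem_toFinset, Set.mem_ofPred_eq] at hR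
  rw [hR.1.gramDet_incidence, map_pow, map_ofNat]
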